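/- Let $d\ge 0$ be an integer and let $A$ be a bounded self-adjoint operator on the real Hilbert space $L^2(\mathbb{R}^d)$ which is strictly positive, i.e. $\langle f,Af\rangle>0$ for all $f\neq 0$. Let $\mathrm{B}_d=\mathbb{R}^d\times(0,\infty)$ with its Euclidean topology, a point $(x,r)$ representing the open ball $b(x,r)$ of centre $x$ and radius $r$; let $v_r$ be the reciprocal of the volume of a $d$-dimensional ball of radius $r$, and set $$A(x,r,y,s)=\langle v_r 1_{b(x,r)},\,A\,v_s 1_{b(y,s)}\rangle_{L^2(\mathbb{R}^d)} .$$ Then: (1) The function $A(x,r,y,s)$ is continuous on $\mathrm{B}_d\times\mathrm{B}_d$. (2) There is a unique measure $\mu_A$ on $\mathbb{R}^{\mathrm{B}_d}$ (with the product $\sigma$-algebra) whose marginal on $\mathbb{R}^S$, for every finite $S\subset\mathrm{B}_d$, is the centered Gaussian measure with covariance matrix $(A(b,c))_{b,c\in S}$. It is a probability measure, and the coordinate field $X^A_b(f)=f(b)$ on $(\mathbb{R}^{\mathrm{B}_d},\mu_A)$ is a centered (jointly) Gaussian random field with covariance $\int X^A_bX^A_c\,d\mu_A=A(b,c)$. (3)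 The field $X^A$ is $L^2$-continuous: $b\mapsto X^A_b$ is a continuous map from $\mathrm{B}_d$ to $L^2(\mu_A)$. (4) $X^A$ has a modification with continuous sample paths, i.e. there are random variables $Y_b$, $b\in\mathrm{B}_d$, with $Y_b=X^A_b$ $\mu_A$-a.s. for every $b$, such that $b\mapsto Y_b(\omega)$ is continuous on $\mathrm{B}_d$ for $\mu_A$-almost every $\omega$. (5) Let $Y$ be any such modification. Then there is a measurable set $\bar\Omega$ with $\mu_A(\bar\Omega)=1$ such that $b\mapsto Y_b(\omega)$ is continuous for all $\omega\in\bar\Omega$. For any such $\bar\Omega$, the map $\bar\Omega\to C(\mathrm{B}_d)$, $\omega\mapsto Y_\bullet(\omega)$, is measurable for the Borel $\sigma$-algebra of $C(\mathrm{B}_d)$ (the space of continuous real functions with the topology of uniform convergence on compact sets). The image $\widetilde\mu_A$ of $\mu_A|_{\bar\Omega}$ under it is a Borel Gaussian probability measure on $C(\mathrm{B}_d)$ (every continuous linear functional has a Gaussian law), and the image of $\widetilde\mu_A$ under $f\mapsto (f(b))_{b\in\mathrm{B}_d}$ is $\mu_A$. -/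

import Mathlib

open MeasureTheory ProbabilityTheory

/-- The real Hilbert space `L²(ℝᵈ)`. -/
abbrev L2Space (d : ℕ) : Type :=
  Lp ℝ 2 (volume : Measure (EuclideanSpace ℝ (Fin d)))

/-- The space `B_d` of open balls of `ℝᵈ`, identified with `ℝᵈ × (0, ∞)`: the pair `(x, r)` stands
for the ball with centre `x` and radius `r`. Its topology, the product topology, is the one given
by the Euclidean metric. -/
abbrev BallSpace (d : ℕ) : Type :=
  EuclideanSpace ℝ (Fin d) × Set.Ioi (0 : ℝ)

/-- A bounded operator `A` on `L²(ℝᵈ)` is self-adjoint and strictly positive: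
`⟨f, A f⟩ > 0` for every `f ≠ 0`. (`A` need not be bounded from below: `(1 - Δ)⁻¹` is included.) -/
def IsStrictlyPositiveOp {d : ℕ} (A : L2Space d →L[ℝ] L2Space d) : Prop :=
  IsSelfAdjoint A ∧ ∀ f : L2Space d, f ≠ 0 → 0 < inner ℝ f (A f)

/-- `v_r`, the reciprocal of the volume of a `d`-dimensional ball of radius `r`. -/
noncomputable def ballVolInv (d : ℕ) (r : ℝ) : ℝ :=
  (volume.real (Metric.ball (0 : EuclideanSpace ℝ (Fin d)) r))⁻¹

/-- The normalized indicator function `v_r 1_{b(x,r)}` as an element of `L²(ℝᵈ)`. -/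
noncomputable def normIndicator {d : ℕ} (b : BallSpace d) : L2Space d :=
  ballVolInv d b.2 •
    indicatorConstLp 2 (Metric.isOpen_ball (x := b.1) (ε := (b.2 : ℝ))).measurableSet
      measure_ball_lt_top.ne (1 : ℝ)

/-- The covariance function `A(x,r,y,s) = ⟨v_r 1_{b(x,r)}, A (v_s 1_{b(y,s)})⟩`. -/
noncomputable def ballCov {d : ℕ} (A : L2Space d →L[ℝ] L2Space d) (b c : BallSpace d) : ℝ :=
  inner ℝ (normIndicator b) (A (normIndicator c))

section RandomFields

variable {T Ω : Type*}

open scoped Classical in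
/-- For each finite `S ⊆ T`, the centered Gaussian probability measure on `ℝ^S` with covariance
matrix `(C s t)` for `s, t ∈ S`. -/
noncomputable def gaussianFamily (C : T → T → ℝ) (S : Finset T) : Measure (S → ℝ) :=
  (multivariateGaussian 0 (Matrix.of fun s t : S => C s t)).map WithLp.ofLp

/-- `μ` is the centered Gaussian measure on `ℝ^T` (with the product `σ`-algebra) with covariance
`C`: its finite-dimensional marginals are those of `gaussianFamily C`. -/
def IsGaussianFieldMeasure (C : T → T → ℝ) (μ : Measure (T → ℝ)) : Prop :=
  IsProjectiveLimit μ (gaussianFamily C)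

/-- The canonical random field on `ℝ^T`, given by the coordinates: `X_t(f) = f(t)`. -/
def canonicalField (T : Type*) : T → (T → ℝ) → ℝ := fun t f => f t

/-- The random field `X` is continuous as a map from `T` to `L²(Ω, μ)` with the norm topology. -/
def IsL2Continuous [TopologicalSpace T] {mΩ : MeasurableSpace Ω} (X : T → Ω → ℝ)
    (μ : Measure Ω) : Prop :=
  ∃ h : ∀ t, MemLp (X t) 2 μ, Continuous fun t => (h t).toLp (X t)

/-- The random field `Y` is a modification of `X`. -/
def IsModificationOf {mΩ : MeasurableSpace Ω} (Y X : T → Ω → ℝ) (μ : Measure Ω) : Prop :=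
  (∀ t, Measurable (Y t)) ∧ ∀ t, Y t =ᵐ[μ] X t

/-- The sample paths `t ↦ X_t(ω)` are continuous for `μ`-almost all `ω`. -/
def HasContinuousSamplePaths [TopologicalSpace T] {mΩ : MeasurableSpace Ω} (X : T → Ω → ℝ)
    (μ : Measure Ω) : Prop :=
  ∀ᵐ ω ∂μ, Continuous fun t => X t ω

/-- The space `C(T)` of continuous functions, with the topology of uniform convergence on compact
sets (compact-open topology), carries its Borel `σ`-algebra. -/
instance instMeasurableSpaceContinuousMapReal [TopologicalSpace T] : MeasurableSpace C(T, ℝ) :=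
  borel _

instance instBorelSpaceContinuousMapReal [TopologicalSpace T] : BorelSpace C(T, ℝ) := ⟨rfl⟩

/-- If the sample paths of `Y` are continuous for all `ω ∈ S`, the induced map `S → C(T)`. -/
def pathMap [TopologicalSpace T] (Y : T → Ω → ℝ) (S : Set Ω)
    (h : ∀ ω ∈ S, Continuous fun t => Y t ω) : S → C(T, ℝ) :=
  fun ω => ⟨fun t => Y t ω, h ω ω.2⟩

/-- The measure on `C(T)` induced by `μ` and `Y`: the image under `pathMap` of the restriction of
`μ` to `S`. -/
noncomputable def pathMeasure [TopologicalSpace T] {mΩ : MeasurableSpace Ω} (μ : Measure Ω)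
    (Y : T → Ω → ℝ) (S : Set Ω) (h : ∀ ω ∈ S, Continuous fun t => Y t ω) : Measure C(T, ℝ) :=
  (μ.comap (Subtype.val : S → Ω)).map (pathMap Y S h)

end RandomFields

/-!
# Gaussian random fields indexed by balls

The covariance `ballCov A` is a positive semidefinite kernel, because it is the pull-back of the
form `⟨f, A g⟩` under `φ : b ↦ v_r 1_b`. Hence the finite-dimensional centered Gaussian measures
with this covariance are consistent, and the Kolmogorov extension theorem
(`exists_isProjectiveLimit`) provides the measure on `ℝ^(B_d)`. It is proved for finite measures on
Polish spaces: compact sets approximate the bases of the cylinders from inside, and cylinders over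
compact sets have the finite intersection property.

All regularity comes from one geometric estimate, `norm_normIndicator_sub_sq_le`: two balls of close
centres and radii overlap up to a proportion of their volume that is at most linear in the distance,
so `‖φ b - φ c‖²` is locally bounded by a multiple of the distance of `b` and `c`. The continuity of
the covariance and the `L²`-continuity of the field follow. Moreover the increments of the field are
Gaussian with variance at most `‖A‖ ‖φ b - φ c‖²`, hence have Gaussian tails. Approximating a ball
by points of lattices of mesh `16⁻ⁿ`, the number of links between lattice points at distance of
order `16⁻ⁿ` in a bounded region is exponential in `n`, whereas the probability that the increment
along a link exceeds `2⁻ⁿ` is of order `exp (-κ 4ⁿ)`. By Borel–Cantelli the field converges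
along the lattice approximations, and the limit is a continuous modification
(`exists_continuous_modification_of_chaining`).

The Borel `σ`-algebra of `C(B_d)` is generated by the evaluations because `B_d` is locally compact
and second countable (`measurable_continuousMap_of_eval`). For the Gaussian property of the path
measure, every `f ∈ C(B_d)` is the limit of interpolations `∑ f(tᵢ) ψᵢ` built from partitions of
unity that do not depend on `f` (`exists_interpolation`), so a continuous linear functional of the
path is a pointwise limit of linear combinations of values of the field. A pointwise limit of
centered Gaussian variables is Gaussian (`hasGaussianLaw_of_tendsto`).
-/

/-! ### The Kolmogorov extension theorem -/

section KolmogorovExtension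

open Filter Topology Set

variable {ι : Type*} {X : ι → Type*} [∀ i, TopologicalSpace (X i)]

/-- Cylinders over compact sets form a compact system: if every finite subfamily has a common
point, so does the whole sequence. -/
lemma nonempty_iInter_cylinder_of_isCompact [∀ i, T2Space (X i)] {I : ℕ → Finset ι}
    {K : ∀ n, Set (∀ i : I n, X i)} (hK : ∀ n, IsCompact (K n))
    (hne : ∀ n, (⋂ k ≤ n, cylinder (I k) (K k)).Nonempty) :
    (⋂ n, cylinder (I n) (K n)).Nonempty := by
  classical
  choose x hx using hne
  simp only [mem_iInter, mem_cylinder] at hx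
  -- The coordinates outside all the `I k` are not controlled by the compact sets: freeze them.
  let z : ℕ → ∀ i, X i := fun n i => if ∃ k, i ∈ I k then x n i else x 0 i
  have hz : ∀ k n, k ≤ n → z n ∈ cylinder (I k) (K k) := by
    intro k n hkn
    rw [mem_cylinder]
    convert! hx n k hkn using 1
    funext i
    exact if_pos ⟨k, i.2⟩
  have hcoord : ∀ i, ∃ Q : Set (X i), IsCompact Q ∧ ∀ n, z n i ∈ Q := by
    intro i
    by_cases h : ∃ k, i ∈ I k
    · obtain ⟨k, hk⟩ := h
      refine ⟨(fun y : ∀ j : I k, X j => y ⟨i, hk⟩) '' K k ∪ (fun n => z n i) '' Iio k,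
        ((hK k).image (continuous_apply _)).union ((finite_Iio k).image _).isCompact, fun n => ?_⟩
      rcases le_or_gt k n with hkn | hkn
      · exact Or.inl ⟨_, (mem_cylinder _ _ _).1 (hz k n hkn), rfl⟩
      · exact Or.inr ⟨n, hkn, rfl⟩
    · exact ⟨{x 0 i}, isCompact_singleton, fun n => if_neg h⟩
  choose Q hQc hQ using hcoord
  obtain ⟨y, -, hy⟩ := (isCompact_univ_pi hQc).exists_mapClusterPt (f := atTop) (u := z)
    (tendsto_principal.2 (Eventually.of_forall fun n i _ => hQ i n))
  refine ⟨y, mem_iInter.2 fun k => ?_⟩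
  have hclosed : IsClosed (cylinder (I k) (K k)) :=
    (hK k).isClosed.preimage (continuous_pi fun i => continuous_apply _)
  rw [← hclosed.closure_eq, mem_closure_iff_clusterPt]
  refine ClusterPt.mono hy (tendsto_principal.2 ?_)
  filter_upwards [eventually_ge_atTop k] with n hn using hz k n hn

variable [∀ i, PolishSpace (X i)] [∀ i, MeasurableSpace (X i)] [∀ i, BorelSpace (X i)]
  {P : ∀ J : Finset ι, Measure (∀ j : J, X j)} [∀ J, IsFiniteMeasure (P J)]

/-- The content defined by a projective family of finite measures on Polish spaces is continuous
at `∅`, by inner regularity with respect to compact sets. -/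
lemma projectiveFamilyContent_tendsto_zero (hP : IsProjectiveMeasureFamily P)
    {A : ℕ → Set (∀ i, X i)} (hA : ∀ n, A n ∈ measurableCylinders X) (hanti : Antitone A)
    (hinter : ⋂ n, A n = ∅) :
    Tendsto (fun n => projectiveFamilyContent hP (A n)) atTop (𝓝 0) := by
  have hlim := tendsto_atTop_iInf (f := fun n => projectiveFamilyContent hP (A n))
    fun m n hmn => projectiveFamilyContent_mono hP (hA n) (hA m) (hanti hmn)
  convert hlim
  by_contra hne
  obtain ⟨δ, hδ, hsum⟩ := ENNReal.exists_pos_sum_of_countable' (Ne.symm hne) ℕ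
  simp only [mem_measurableCylinders] at hA
  choose I S hS hAS using hA
  have hcpt : ∀ n, ∃ K ⊆ S n, IsCompact K ∧ P (I n) (S n \ K) < δ n := fun n =>
    (hS n).exists_isCompact_sdiff_lt (measure_ne_top _ _) (hδ n).ne'
  choose K hKS hK hKδ using hcpt
  have hmem : ∀ n, A n \ cylinder (I n) (K n) = cylinder (I n) (S n \ K n) := fun n => by
    rw [hAS n]; rfl
  have hSK : ∀ n, MeasurableSet (S n \ K n) := fun n => (hS n).diff (hK n).measurableSet
  obtain ⟨y, hy⟩ := nonempty_iInter_cylinder_of_isCompact hK fun n => by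
    by_contra hempty
    rw [not_nonempty_iff_eq_empty] at hempty
    have hsub : A n ⊆ ⋃ k ≤ n, cylinder (I k) (S k \ K k) := by
      intro x hx
      have : x ∉ ⋂ k ≤ n, cylinder (I k) (K k) := by simp [hempty]
      simp only [mem_iInter, not_forall] at this
      obtain ⟨k, hk, hxk⟩ := this
      simp only [mem_iUnion]
      exact ⟨k, hk, hmem k ▸ ⟨hanti hk hx, hxk⟩⟩
    have hcyl : ∀ k, cylinder (I k) (S k \ K k) ∈ measurableCylinders X := fun k =>
      cylinder_mem_measurableCylinders _ _ (hSK k)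
    have hle : projectiveFamilyContent hP (A n) ≤ ∑ k ∈ Finset.range (n + 1), δ k := by
      refine (projectiveFamilyContent_mono hP
        ((mem_measurableCylinders _).2 ⟨I n, S n, hS n, hAS n⟩) ?_ hsub).trans
        ((projectiveFamilyContent_iUnion_le hP hcyl n).trans
          (Finset.sum_le_sum fun k _ => ?_))
      · have : (⋃ k ≤ n, cylinder (I k) (S k \ K k)) =
            ⋃ k ∈ Finset.range (n + 1), cylinder (I k) (S k \ K k) := by
          simp only [Finset.mem_range_succ_iff]
        rw [this]
        exact isSetRing_measurableCylinders.biUnion_mem _ fun k _ => hcyl k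
      · rw [projectiveFamilyContent_cylinder hP (hSK k)]
        exact (hKδ k).le
    exact absurd ((iInf_le _ n).trans (hle.trans (ENNReal.sum_le_tsum _))) (not_le.2 hsum)
  have : y ∈ ⋂ n, A n := mem_iInter.2 fun n => by
    rw [hAS n]
    exact hKS n (mem_iInter.1 hy n)
  simp [hinter] at this

/-- **Kolmogorov extension theorem** for finite measures on Polish spaces. -/
theorem exists_isProjectiveLimit (hP : IsProjectiveMeasureFamily P) :
    ∃ μ : Measure (∀ i, X i), IsProjectiveLimit μ P := by
  have hsub : (projectiveFamilyContent hP).IsSigmaSubadditive :=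
    isSigmaSubadditive_of_addContent_iUnion_eq_tsum isSetRing_measurableCylinders
      fun f hf hfU hf' => addContent_iUnion_eq_sum_of_tendsto_zero isSetRing_measurableCylinders
        _ (fun s _ => projectiveFamilyContent_ne_top hP)
        (fun _ hs hanti hi => projectiveFamilyContent_tendsto_zero hP hs hanti hi) hf hfU hf'
  refine ⟨(projectiveFamilyContent hP).measure isSetSemiring_measurableCylinders
    generateFrom_measurableCylinders.ge hsub, fun I => ?_⟩
  ext s hs
  rw [Measure.map_apply (Finset.measurable_restrict I) hs, AddContent.measure_eq, ← cylinder,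
    projectiveFamilyContent_cylinder hP hs]
  · exact generateFrom_measurableCylinders.symm
  · exact cylinder_mem_measurableCylinders _ _ hs

end KolmogorovExtension

/-! ### Gaussian measures on `ℝ^T` with a given covariance -/

section GaussianField

open WithLp

variable {T : Type*} {C : T → T → ℝ}

/-- The kernel `C` is positive semidefinite: all its finite sections are positive semidefinite
matrices. -/
def IsPosSemidefKernel (C : T → T → ℝ) : Prop :=
  ∀ S : Finset T, (Matrix.of fun s t : S => C s t).PosSemidef

instance isGaussian_gaussianFamily (S : Finset T) : IsGaussian (gaussianFamily C S) := by
  classical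
  rw [gaussianFamily, show (ofLp : EuclideanSpace ℝ S → S → ℝ) = ⇑(EuclideanSpace.equiv S ℝ)
    from rfl]
  infer_instance

lemma isProjectiveMeasureFamily_gaussianFamily (hC : IsPosSemidefKernel C) :
    IsProjectiveMeasureFamily (α := fun _ => ℝ) (gaussianFamily C) := by
  classical
  intro I J hJI
  have h := (measurePreserving_restrict₂_multivariateGaussian (μ := 0) (hC I) hJI).map_eq
  have hcomp : Finset.restrict₂ (π := fun _ => ℝ) hJI ∘ (ofLp : EuclideanSpace ℝ I → I → ℝ) =
      ofLp ∘ EuclideanSpace.restrict₂ hJI := by ext; simp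
  simp only [gaussianFamily]
  refine .trans ?_ (Measure.map_map (f := (ofLp : EuclideanSpace ℝ I → I → ℝ))
    (Finset.measurable_restrict₂ hJI) (by fun_prop)).symm
  rw [hcomp, ← Measure.map_map (by fun_prop) (by fun_prop), h, map_zero]
  rfl

lemma exists_isGaussianFieldMeasure (hC : IsPosSemidefKernel C) :
    ∃ μ : Measure (T → ℝ), IsGaussianFieldMeasure C μ :=
  exists_isProjectiveLimit (isProjectiveMeasureFamily_gaussianFamily hC)

namespace IsGaussianFieldMeasure

variable {μ : Measure (T → ℝ)}

lemma isProbabilityMeasure (hμ : IsGaussianFieldMeasure C μ) : IsProbabilityMeasure μ :=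
  IsProjectiveLimit.isProbabilityMeasure hμ

lemma isGaussianProcess (hμ : IsGaussianFieldMeasure C μ) :
    IsGaussianProcess (canonicalField T) μ where
  hasGaussianLaw I := ⟨by
    change IsGaussian (μ.map I.restrict)
    rw [hμ I]
    infer_instance⟩

/-- A function of finitely many coordinates is integrated with the Gaussian marginal. -/
lemma integral_restrict (hμ : IsGaussianFieldMeasure C μ) (I : Finset T) {f : (I → ℝ) → ℝ}
    (hf : Measurable f) : ∫ ω, f (I.restrict ω) ∂μ = ∫ x, f x ∂gaussianFamily C I := by
  rw [← hμ I, integral_map (Finset.measurable_restrict I).aemeasurable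
    hf.aestronglyMeasurable]

lemma integral_eval (hμ : IsGaussianFieldMeasure C μ) (t : T) :
    ∫ ω, canonicalField T t ω ∂μ = 0 := by
  classical
  have ht : t ∈ ({t} : Finset T) := by simp
  have h := hμ.integral_restrict {t} (f := fun x => x ⟨t, ht⟩) (by fun_prop)
  refine h.trans ((integral_map (f := fun x : ({t} : Finset T) → ℝ => x ⟨t, ht⟩) (by fun_prop)
    (measurable_pi_apply _).aestronglyMeasurable).trans ?_)
  have h2 := (EuclideanSpace.proj (𝕜 := ℝ) (⟨t, ht⟩ : ({t} : Finset T))).integral_comp_id_comm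
    (μ := multivariateGaussian 0 (Matrix.of fun s t : ({t} : Finset T) => C s t))
    IsGaussian.integrable_id
  simpa using h2

lemma integral_mul (hC : IsPosSemidefKernel C) (hμ : IsGaussianFieldMeasure C μ) (s t : T) :
    ∫ ω, canonicalField T s ω * canonicalField T t ω ∂μ = C s t := by
  classical
  have hs : s ∈ ({s, t} : Finset T) := by simp
  have ht : t ∈ ({s, t} : Finset T) := by simp
  have hprob := hμ.isProbabilityMeasure
  have hG := hμ.isGaussianProcess
  have hcov : cov[canonicalField T s, canonicalField T t; μ] = C s t := by
    have h := covariance_eval_multivariateGaussian (μ := 0) (hC {s, t}) ⟨s, hs⟩ ⟨t, ht⟩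
    have h1 := covariance_map_fun (μ := μ) (Z := Finset.restrict (π := fun _ => ℝ) {s, t})
      (X := fun x => x ⟨s, hs⟩) (Y := fun x => x ⟨t, ht⟩)
      (measurable_pi_apply _).aestronglyMeasurable (measurable_pi_apply _).aestronglyMeasurable
      (by fun_prop)
    have h2 := covariance_map_fun
      (μ := multivariateGaussian 0 (Matrix.of fun i j : ({s, t} : Finset T) => C i j))
      (Z := ofLp)
      (X := fun x => x ⟨s, hs⟩) (Y := fun x => x ⟨t, ht⟩)
      (measurable_pi_apply _).aestronglyMeasurable (measurable_pi_apply _).aestronglyMeasurable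
      (by fun_prop)
    rw [hμ {s, t}] at h1
    exact h1.symm.trans (h2.trans h)
  rw [← hcov, covariance_eq_sub (hG.hasGaussianLaw_eval s).memLp_two
    (hG.hasGaussianLaw_eval t).memLp_two, hμ.integral_eval, hμ.integral_eval]
  simp

end IsGaussianFieldMeasure

end GaussianField

/-! ### Normalized indicator functions of balls in `L²` -/

section Balls

open Filter Topology Metric

variable {d : ℕ}

lemma volume_real_ball_pos {r : ℝ} (hr : 0 < r) :
    0 < volume.real (ball (0 : EuclideanSpace ℝ (Fin d)) r) :=
  ENNReal.toReal_pos (measure_ball_pos volume 0 hr).ne' measure_ball_lt_top.ne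

lemma ballVolInv_pos {r : ℝ} (hr : 0 < r) : 0 < ballVolInv d r :=
  inv_pos.2 (volume_real_ball_pos hr)

lemma ballVolInv_anti {r s : ℝ} (hr : 0 < r) (hrs : r ≤ s) : ballVolInv d s ≤ ballVolInv d r :=
  inv_anti₀ (volume_real_ball_pos hr)
    (measureReal_mono (ball_subset_ball hrs) measure_ball_lt_top.ne)

lemma volume_real_ball_center (x : EuclideanSpace ℝ (Fin d)) (r : ℝ) :
    volume.real (ball x r) = volume.real (ball (0 : EuclideanSpace ℝ (Fin d)) r) := by
  rw [measureReal_def, measureReal_def, Measure.addHaar_ball_center]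

/-- The intersection of two balls contains a ball concentric to the first whose radius is smaller
by at most `|x - y| + |r - s|`; Bernoulli's inequality then bounds its volume. The factor is `d + 1`
instead of `d` so that the bound holds trivially when that radius is negative, even if `d = 0`. -/
lemma mul_le_volume_real_inter (x y : EuclideanSpace ℝ (Fin d)) {r : ℝ} (hr : 0 < r) (s : ℝ) :
    (1 - (d + 1) * (dist x y + |r - s|) / r) *
        volume.real (ball (0 : EuclideanSpace ℝ (Fin d)) r) ≤
      volume.real (ball x r ∩ ball y s) := by
  set δ := dist x y + |r - s| with hδ
  have hδ0 : 0 ≤ δ := by positivity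
  rcases le_or_gt r δ with h | h
  · refine le_trans (mul_nonpos_of_nonpos_of_nonneg ?_ measureReal_nonneg) measureReal_nonneg
    rw [sub_nonpos, le_div_iff₀ hr]
    nlinarith [(Nat.cast_nonneg d : (0 : ℝ) ≤ d)]
  have hq : 0 < (r - δ) / r := div_pos (by linarith) hr
  have hsub : ball x (r - δ) ⊆ ball x r ∩ ball y s := by
    refine Set.subset_inter (ball_subset_ball (by linarith)) (ball_subset_ball' ?_)
    have := le_abs_self (r - s)
    linarith
  have hvol : volume.real (ball x (r - δ)) =
      ((r - δ) / r) ^ d * volume.real (ball (0 : EuclideanSpace ℝ (Fin d)) r) := by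
    have h1 := Measure.addHaar_ball_mul_of_pos (volume : Measure (EuclideanSpace ℝ (Fin d))) x hq r
    rw [div_mul_cancel₀ _ hr.ne', finrank_euclideanSpace_fin] at h1
    rw [measureReal_def, h1, ENNReal.toReal_mul, ENNReal.toReal_ofReal (by positivity),
      measureReal_def]
  refine le_trans ?_ (measureReal_mono hsub
    ((measure_mono Set.inter_subset_left).trans_lt measure_ball_lt_top).ne)
  rw [hvol]
  refine mul_le_mul_of_nonneg_right ?_ measureReal_nonneg
  have hle : δ / r ≤ 1 := (div_le_one hr).2 h.le
  have hb := one_add_mul_le_pow (a := -(δ / r)) (by linarith) d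
  have hδr : 0 ≤ δ / r := by positivity
  calc 1 - (d + 1) * δ / r ≤ 1 + d * -(δ / r) := by rw [mul_div_assoc]; linarith
    _ ≤ (1 + -(δ / r)) ^ d := hb
    _ = ((r - δ) / r) ^ d := by rw [sub_div, div_self hr.ne', sub_eq_add_neg]

lemma inner_normIndicator (b c : BallSpace d) :
    inner ℝ (normIndicator b) (normIndicator c) =
      ballVolInv d b.2 * ballVolInv d c.2 * volume.real (ball b.1 b.2 ∩ ball c.1 c.2) := by
  rw [normIndicator, normIndicator, real_inner_smul_left, real_inner_smul_right,
    L2.real_inner_indicatorConstLp_one_indicatorConstLp_one, mul_assoc]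

/-- The map `b ↦ v_r 1_b` into `L²` is locally `1/2`-Hölder continuous. -/
lemma norm_normIndicator_sub_sq_le (b c : BallSpace d) :
    ‖normIndicator b - normIndicator c‖ ^ 2 ≤
      (d + 1) * (dist b.1 c.1 + |(b.2 : ℝ) - c.2|) *
        (ballVolInv d c.2 / b.2 + ballVolInv d b.2 / c.2) := by
  obtain ⟨x, r, hr⟩ := b
  obtain ⟨y, s, hs⟩ := c
  rw [Set.mem_Ioi] at hr hs
  rw [norm_sub_sq_real, ← real_inner_self_eq_norm_sq, ← real_inner_self_eq_norm_sq]
  simp only [inner_normIndicator, Set.inter_self, volume_real_ball_center]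
  have h1 := mul_le_volume_real_inter x y hr s
  have h2 := mul_le_volume_real_inter y x hs r
  rw [dist_comm, abs_sub_comm, Set.inter_comm] at h2
  set δ := dist x y + |r - s| with hδ
  set J := volume.real (ball x r ∩ ball y s) with hJ
  have hv := ballVolInv_pos (d := d) hr
  have hw := ballVolInv_pos (d := d) hs
  have hvV : ballVolInv d r * volume.real (ball (0 : EuclideanSpace ℝ (Fin d)) r) = 1 :=
    inv_mul_cancel₀ (volume_real_ball_pos hr).ne'
  have hwV : ballVolInv d s * volume.real (ball (0 : EuclideanSpace ℝ (Fin d)) s) = 1 :=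
    inv_mul_cancel₀ (volume_real_ball_pos hs).ne'
  set v := ballVolInv d r with hvdef
  set w := ballVolInv d s with hwdef
  set V := volume.real (ball (0 : EuclideanSpace ℝ (Fin d)) r)
  set W := volume.real (ball (0 : EuclideanSpace ℝ (Fin d)) s)
  have h3 : w * (1 - (d + 1) * δ / r) ≤ v * w * J := by
    have := mul_le_mul_of_nonneg_left h1 (mul_pos hv hw).le
    calc w * (1 - (d + 1) * δ / r) = (v * V) * (w * (1 - (d + 1) * δ / r)) := by rw [hvV, one_mul]
      _ = v * w * ((1 - (d + 1) * δ / r) * V) := by ring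
      _ ≤ _ := this
  have h4 : v * (1 - (d + 1) * δ / s) ≤ v * w * J := by
    have := mul_le_mul_of_nonneg_left h2 (mul_pos hv hw).le
    calc v * (1 - (d + 1) * δ / s) = (w * W) * (v * (1 - (d + 1) * δ / s)) := by rw [hwV, one_mul]
      _ = v * w * ((1 - (d + 1) * δ / s) * W) := by ring
      _ ≤ _ := this
  calc v * v * V - 2 * (v * w * J) + w * w * W
      = v * (v * V) + w * (w * W) - 2 * (v * w * J) := by ring
    _ = v + w - 2 * (v * w * J) := by rw [hvV, hwV]; ring
    _ ≤ v + w - w * (1 - (d + 1) * δ / r) - v * (1 - (d + 1) * δ / s) := by linarith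
    _ = (d + 1) * δ * (w / r + v / s) := by ring

lemma norm_normIndicator_sub_sq_le_of_le {ε : ℝ} (hε : 0 < ε) {b c : BallSpace d}
    (hb : ε ≤ b.2) (hc : ε ≤ c.2) :
    ‖normIndicator b - normIndicator c‖ ^ 2 ≤
      (4 * (d + 1) * (ballVolInv d ε / ε)) * dist b c := by
  have hbc : dist b.1 c.1 + |(b.2 : ℝ) - c.2| ≤ 2 * dist b c := by
    have h1 : dist b.1 c.1 ≤ dist b c := le_max_left _ _
    have h2 : |(b.2 : ℝ) - c.2| ≤ dist b c := le_max_right _ _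
    linarith
  have key : ∀ {r s : ℝ}, ε ≤ r → ε ≤ s → ballVolInv d s / r ≤ ballVolInv d ε / ε := fun hr hs =>
    div_le_div₀ (ballVolInv_pos hε).le (ballVolInv_anti hε hs) hε hr
  refine (norm_normIndicator_sub_sq_le b c).trans ?_
  have hpos := (ballVolInv_pos (d := d) hε)
  calc _ ≤ (d + 1) * (2 * dist b c) * (ballVolInv d ε / ε + ballVolInv d ε / ε) := by
        have h0 : 0 ≤ ballVolInv d c.2 / b.2 + ballVolInv d b.2 / c.2 :=
          add_nonneg (div_nonneg (ballVolInv_pos c.2.2).le (le_of_lt b.2.2))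
            (div_nonneg (ballVolInv_pos b.2.2).le (le_of_lt c.2.2))
        exact mul_le_mul (mul_le_mul_of_nonneg_left hbc (by positivity))
          (add_le_add (key hb hc) (key hc hb)) h0 (by positivity)
    _ = _ := by ring

lemma continuous_normIndicator : Continuous (normIndicator : BallSpace d → L2Space d) := by
  refine continuous_iff_continuousAt.2 fun b => ?_
  have hε : 0 < (b.2 : ℝ) / 2 := half_pos b.2.2
  rw [ContinuousAt, tendsto_iff_norm_sub_tendsto_zero]
  have hsq : Tendsto (fun c => ‖normIndicator c - normIndicator b‖ ^ 2) (𝓝 b) (𝓝 0) := by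
    have hev : ∀ᶠ c : BallSpace d in 𝓝 b, (b.2 : ℝ) / 2 < c.2 :=
      (continuous_subtype_val.comp continuous_snd).continuousAt.eventually
        (lt_mem_nhds (half_lt_self b.2.2))
    have hlim : Tendsto (fun c : BallSpace d => (4 * (d + 1) *
        (ballVolInv d ((b.2 : ℝ) / 2) / ((b.2 : ℝ) / 2))) * dist c b) (𝓝 b) (𝓝 0) := by
      have : Continuous fun c : BallSpace d => (4 * (d + 1) *
        (ballVolInv d ((b.2 : ℝ) / 2) / ((b.2 : ℝ) / 2))) * dist c b := by fun_prop
      simpa using this.tendsto b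
    refine squeeze_zero' (Eventually.of_forall fun _ => by positivity) ?_ hlim
    filter_upwards [hev] with c hc
    exact norm_normIndicator_sub_sq_le_of_le hε hc.le (half_le_self (le_of_lt b.2.2))
  simpa [Real.sqrt_sq] using hsq.sqrt

variable {A : L2Space d →L[ℝ] L2Space d}

lemma continuous_ballCov (A : L2Space d →L[ℝ] L2Space d) :
    Continuous fun p : BallSpace d × BallSpace d => ballCov A p.1 p.2 :=
  (continuous_normIndicator.comp continuous_fst).inner
    (A.continuous.comp (continuous_normIndicator.comp continuous_snd))

lemma IsStrictlyPositiveOp.inner_nonneg (hA : IsStrictlyPositiveOp A) (f : L2Space d) :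
    0 ≤ inner ℝ f (A f) := by
  rcases eq_or_ne f 0 with rfl | hf
  · simp
  · exact (hA.2 f hf).le

lemma IsStrictlyPositiveOp.inner_comm (hA : IsStrictlyPositiveOp A) (f g : L2Space d) :
    inner ℝ f (A g) = inner ℝ g (A f) :=
  (ContinuousLinearMap.isSelfAdjoint_iff_isSymmetric.1 hA.1 f g).symm.trans
    (real_inner_comm _ _)

lemma IsStrictlyPositiveOp.isPosSemidefKernel_ballCov (hA : IsStrictlyPositiveOp A) :
    IsPosSemidefKernel (ballCov A) := by
  intro S
  refine Matrix.PosSemidef.of_dotProduct_mulVec_nonneg ?_ fun x => ?_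
  · ext b c
    exact hA.inner_comm _ _
  · have h := hA.inner_nonneg (∑ b : S, x b • normIndicator (b : BallSpace d))
    rw [map_sum, sum_inner] at h
    simp only [map_smul, inner_sum, real_inner_smul_left, real_inner_smul_right] at h
    simpa [dotProduct, Matrix.mulVec, ballCov, Finset.mul_sum, mul_left_comm, mul_comm] using h

/-- The variance of an increment of a field with covariance `ballCov A`. -/
lemma IsStrictlyPositiveOp.ballCov_sub_le (hA : IsStrictlyPositiveOp A) (b c : BallSpace d) :
    ballCov A b b - 2 * ballCov A b c + ballCov A c c ≤
      ‖A‖ * ‖normIndicator b - normIndicator c‖ ^ 2 := by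
  set f := normIndicator b
  set g := normIndicator c
  have h : ballCov A b b - 2 * ballCov A b c + ballCov A c c = inner ℝ (f - g) (A (f - g)) := by
    simp only [ballCov, map_sub, inner_sub_left, inner_sub_right]
    rw [hA.inner_comm g f]
    ring
  rw [h]
  calc inner ℝ (f - g) (A (f - g)) ≤ ‖f - g‖ * ‖A (f - g)‖ := real_inner_le_norm _ _
    _ ≤ ‖f - g‖ * (‖A‖ * ‖f - g‖) := by gcongr; exact A.le_opNorm _
    _ = _ := by ring

end Balls

/-! ### Increments of Gaussian fields -/

section GaussianField

open Filter Topology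

/-- Gaussian tail bound for a centered Gaussian variable whose variance is at most `v`. -/
lemma ProbabilityTheory.HasGaussianLaw.measure_le_abs_le {Ω : Type*} {mΩ : MeasurableSpace Ω} {μ : Measure Ω}
    {Z : Ω → ℝ} (hZ : HasGaussianLaw Z μ) (hmean : ∫ ω, Z ω ∂μ = 0) {v : ℝ} (hv : 0 < v)
    (hvar : ∫ ω, Z ω ^ 2 ∂μ ≤ v) {a : ℝ} (ha : 0 ≤ a) :
    μ {ω | a ≤ |Z ω|} ≤ ENNReal.ofReal (2 * Real.exp (-a ^ 2 / (2 * v))) := by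
  lift v to NNReal using hv.le
  have hprob := hZ.isProbabilityMeasure
  have hlaw := hZ.map_eq_gaussianReal
  have hVar : Var[Z; μ] ≤ v := by
    rw [variance_of_integral_eq_zero hZ.aemeasurable hmean]
    exact hvar
  have hsub : HasSubgaussianMGF Z v μ := by
    refine ⟨fun t => ?_, fun t => ?_⟩
    · have h := integrable_exp_mul_gaussianReal (μ := μ[Z]) (v := Var[Z; μ].toNNReal) t
      rw [← hlaw] at h
      exact h.comp_aemeasurable hZ.aemeasurable
    · rw [mgf_gaussianReal hlaw, hmean, zero_mul, zero_add,
        Real.coe_toNNReal _ (variance_nonneg _ _)]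
      exact Real.exp_le_exp.2 (by gcongr)
  have h1 := hsub.measure_ge_le ha
  have h2 := hsub.neg.measure_ge_le ha
  have hunion : {ω | a ≤ |Z ω|} = {ω | a ≤ Z ω} ∪ {ω | a ≤ (-Z) ω} := by
    ext ω; simp [le_abs]
  rw [← ENNReal.ofReal_toReal (measure_ne_top μ _)]
  refine ENNReal.ofReal_le_ofReal ?_
  rw [hunion]
  refine (measureReal_union_le _ _).trans ?_
  linarith

namespace IsGaussianFieldMeasure

variable {T : Type*} {C : T → T → ℝ} {μ : Measure (T → ℝ)}

lemma memLp_two (hμ : IsGaussianFieldMeasure C μ) (t : T) : MemLp (canonicalField T t) 2 μ :=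
  (hμ.isGaussianProcess.hasGaussianLaw_eval t).memLp_two

lemma integral_sub_sq (hC : IsPosSemidefKernel C) (hμ : IsGaussianFieldMeasure C μ) (s t : T) :
    ∫ ω, (canonicalField T s ω - canonicalField T t ω) ^ 2 ∂μ = C s s - 2 * C s t + C t t := by
  have hint : ∀ u v : T, Integrable (fun ω => canonicalField T u ω * canonicalField T v ω) μ :=
    fun u v => (hμ.memLp_two u).integrable_mul (hμ.memLp_two v)
  have h : ∀ ω, (canonicalField T s ω - canonicalField T t ω) ^ 2 =
      canonicalField T s ω * canonicalField T s ω -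
        2 * (canonicalField T s ω * canonicalField T t ω) +
        canonicalField T t ω * canonicalField T t ω := fun ω => by ring
  have hsub : Integrable (fun ω => canonicalField T s ω * canonicalField T s ω -
      2 * (canonicalField T s ω * canonicalField T t ω)) μ :=
    (hint s s).sub ((hint s t).const_mul 2)
  simp only [h]
  rw [integral_add hsub (hint t t),
    integral_sub (hint s s) ((hint s t).const_mul 2), integral_const_mul,
    hμ.integral_mul hC, hμ.integral_mul hC, hμ.integral_mul hC]

lemma measure_le_abs_sub_le (hC : IsPosSemidefKernel C) (hμ : IsGaussianFieldMeasure C μ)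
    {s t : T} {v : ℝ} (hv : 0 < v) (hst : C s s - 2 * C s t + C t t ≤ v) {a : ℝ} (ha : 0 ≤ a) :
    μ {ω | a ≤ |canonicalField T s ω - canonicalField T t ω|} ≤
      ENNReal.ofReal (2 * Real.exp (-a ^ 2 / (2 * v))) := by
  have hprob := hμ.isProbabilityMeasure
  refine hμ.isGaussianProcess.hasGaussianLaw_fun_sub.measure_le_abs_le ?_ hv ?_ ha
  · rw [integral_sub ((hμ.memLp_two s).integrable one_le_two)
      ((hμ.memLp_two t).integrable one_le_two), hμ.integral_eval, hμ.integral_eval, sub_zero]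
  · rwa [hμ.integral_sub_sq hC]

lemma isL2Continuous [TopologicalSpace T] (hC : IsPosSemidefKernel C)
    (hμ : IsGaussianFieldMeasure C μ) (hcont : Continuous fun p : T × T => C p.1 p.2) :
    IsL2Continuous (canonicalField T) μ := by
  refine ⟨hμ.memLp_two, continuous_iff_continuousAt.2 fun t => ?_⟩
  rw [ContinuousAt, tendsto_iff_norm_sub_tendsto_zero]
  have hsq : ∀ s, ‖(hμ.memLp_two s).toLp (canonicalField T s) -
      (hμ.memLp_two t).toLp (canonicalField T t)‖ ^ 2 = C s s - 2 * C s t + C t t := by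
    intro s
    rw [← hμ.integral_sub_sq hC, ← MemLp.toLp_sub, ← real_inner_self_eq_norm_sq, L2.inner_def]
    refine integral_congr_ae ?_
    filter_upwards [((hμ.memLp_two s).sub (hμ.memLp_two t)).coeFn_toLp] with ω hω
    rw [hω]
    simp [pow_two]
  have hlim : Tendsto (fun s => C s s - 2 * C s t + C t t) (𝓝 t) (𝓝 0) := by
    have h1 : Continuous fun s => C s s := hcont.comp (continuous_id.prodMk continuous_id)
    have h2 : Continuous fun s => C s t := hcont.comp (continuous_id.prodMk continuous_const)
    have h3 : Continuous fun s => C s s - 2 * C s t + C t t := by fun_prop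
    convert h3.tendsto t using 2
    ring
  have := (hlim.congr fun s => (hsq s).symm).sqrt
  simpa [Real.sqrt_sq] using this

end IsGaussianFieldMeasure

end GaussianField

/-! ### Continuous modifications by chaining -/

section Chaining

open Filter Topology

variable {T Ω : Type*} {mΩ : MeasurableSpace Ω} {μ : Measure Ω} {X : T → Ω → ℝ}

/-- Borel–Cantelli for the increments of a random field along finite sets of pairs. -/
lemma ae_eventually_abs_sub_lt {G : ℕ → Finset (T × T)} {a : ℕ → ℝ}
    (h : ∑' n, ∑ p ∈ G n, μ {ω | a n ≤ |X p.1 ω - X p.2 ω|} ≠ ⊤) :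
    ∀ᵐ ω ∂μ, ∀ᶠ n in atTop, ∀ p ∈ G n, |X p.1 ω - X p.2 ω| < a n := by
  have h' : ∑' n, μ (⋃ p ∈ G n, {ω | a n ≤ |X p.1 ω - X p.2 ω|}) ≠ ⊤ :=
    ne_top_of_le_ne_top h (ENNReal.tsum_le_tsum fun n => measure_biUnion_finset_le _ _)
  filter_upwards [ae_eventually_notMem h'] with ω hω
  filter_upwards [hω] with n hn p hp
  simp only [Set.mem_iUnion, not_exists] at hn
  exact not_le.1 (hn p hp)

/-- The chaining argument. The points `π n t` are approximations of `t`. If the increments of `X`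
along the links `(π n s, π (n + 1) s)` and between `π n s` and `π n t` for `s` close to `t` are
controlled by a summable sequence `a n`, with summable exceptional probabilities, then
`lim X (π n t)` exists and is continuous in `t`. The links may depend on a parameter `m`,
which allows for controls that are only local in `t`. -/
theorem exists_continuous_modification_of_chaining [TopologicalSpace T]
    (hX : ∀ t, Measurable (X t)) {π : ℕ → T → T} {G : ℕ → ℕ → Finset (T × T)} {a : ℕ → ℝ}
    (ha : Summable a)
    (htail : ∀ m, ∑' n, ∑ p ∈ G m n, μ {ω | a n ≤ |X p.1 ω - X p.2 ω|} ≠ ⊤)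
    (hlim : ∀ t, ∑' n, μ {ω | a n ≤ |X (π n t) ω - X t ω|} ≠ ⊤)
    (hG : ∀ t, ∃ m, (∀ᶠ s in 𝓝 t, ∀ n, (π n s, π (n + 1) s) ∈ G m n) ∧
      ∀ n, ∀ᶠ s in 𝓝 t, (π n s, π n t) ∈ G m n) :
    ∃ Y : T → Ω → ℝ, IsModificationOf Y X μ ∧ HasContinuousSamplePaths Y μ := by
  refine ⟨fun t ω => limsup (fun n => X (π n t) ω) atTop, ⟨fun t => .limsup fun n => hX _,
    fun t => ?_⟩, ?_⟩
  · have h := ae_eventually_abs_sub_lt (μ := μ) (X := X) (G := fun n => {(π n t, t)}) (a := a)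
      (by simpa using hlim t)
    filter_upwards [h] with ω hω
    refine Tendsto.limsup_eq (tendsto_iff_dist_tendsto_zero.2 ?_)
    refine squeeze_zero' (Eventually.of_forall fun _ => dist_nonneg) ?_ ha.tendsto_atTop_zero
    filter_upwards [hω] with n hn
    exact (hn _ (Finset.mem_singleton_self _)).le
  · have hgood : ∀ᵐ ω ∂μ, ∀ m, ∀ᶠ n in atTop, ∀ p ∈ G m n, |X p.1 ω - X p.2 ω| < a n :=
      ae_all_iff.2 fun m => ae_eventually_abs_sub_lt (htail m)
    filter_upwards [hgood] with ω hω
    refine continuous_iff_continuousAt.2 fun t => ?_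
    obtain ⟨m, hm1, hm2⟩ := hG t
    obtain ⟨N, hN⟩ := eventually_atTop.1 (hω m)
    -- Summing the links: the error at level `n` is at most the tail of the series.
    have hdist : ∀ s, (∀ n, (π n s, π (n + 1) s) ∈ G m n) → ∀ n ≥ N,
        |X (π n s) ω - limsup (fun n => X (π n s) ω) atTop| ≤ ∑' k, a (k + n) := by
      intro s hs n hn
      have hstep : ∀ k, dist (X (π (k + n) s) ω) (X (π (k + 1 + n) s) ω) ≤ a (k + n) := by
        intro k
        rw [show k + 1 + n = k + n + 1 by ring]
        exact (hN (k + n) (by omega) _ (hs (k + n))).le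
      have hsum : Summable fun k => a (k + n) := (summable_nat_add_iff n).2 ha
      obtain ⟨y, hy⟩ := cauchySeq_tendsto_of_complete
        (cauchySeq_of_dist_le_of_summable (f := fun k => X (π (k + n) s) ω) _ hstep hsum)
      have hy' : Tendsto (fun k => X (π k s) ω) atTop (𝓝 y) :=
        (tendsto_add_atTop_iff_nat (f := fun k => X (π k s) ω) n).1 hy
      rw [hy'.limsup_eq]
      have h0 := dist_le_tsum_of_dist_le_of_tendsto₀ (f := fun k => X (π (k + n) s) ω) _
        hstep hsum hy
      simpa [Real.dist_eq] using h0
    have htails : Tendsto (fun n => 2 * (∑' k, a (k + n)) + a n) atTop (𝓝 0) := by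
      simpa using ((tendsto_sum_nat_add a).const_mul 2).add ha.tendsto_atTop_zero
    rw [Metric.continuousAt_iff']
    intro ε hε
    obtain ⟨n, hnε, hnN⟩ := ((htails.eventually (gt_mem_nhds hε)).and
      (eventually_ge_atTop N)).exists
    filter_upwards [hm1, hm2 n] with s hs hst
    have h1 := hdist s hs n hnN
    have h2 := hdist t hm1.self_of_nhds n hnN
    have h3 := (hN n hnN _ hst).le
    rw [abs_sub_comm] at h1
    rw [Real.dist_eq]
    calc _ ≤ _ := abs_sub_le _ (X (π n s) ω) _
      _ ≤ _ := add_le_add h1 ((abs_sub_le _ (X (π n t) ω) _).trans (add_le_add h3 h2))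
      _ < ε := by linarith

end Chaining

/-! ### Lattice approximations in the space of balls -/

section Lattice

open Filter Topology

variable {d : ℕ}

/-- The lattice point of mesh `1 / N` with integer coordinates `p`; the radius `(k + 1) / N`
is positive. -/
noncomputable def latticeBall (N : ℕ) [NeZero N] (p : (Fin d → ℤ) × ℕ) : BallSpace d :=
  (WithLp.toLp 2 fun i => (p.1 i : ℝ) / N,
    ⟨(p.2 + 1 : ℝ) / N, Set.mem_Ioi.2 (div_pos (by positivity) (Nat.cast_pos.2 (NeZero.pos N)))⟩)

/-- The lattice approximation of mesh `1 / N` of a ball; it never decreases the radius. -/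
noncomputable def latticeApprox (N : ℕ) [NeZero N] (b : BallSpace d) : BallSpace d :=
  latticeBall N (fun i => ⌊N * b.1 i⌋, ⌊N * (b.2 : ℝ)⌋₊)

variable (N : ℕ) [NeZero N]

lemma le_latticeApprox_snd (b : BallSpace d) : (b.2 : ℝ) ≤ (latticeApprox N b).2 := by
  have hN : (0 : ℝ) < N := Nat.cast_pos.2 (NeZero.pos N)
  change (b.2 : ℝ) ≤ (⌊N * (b.2 : ℝ)⌋₊ + 1 : ℝ) / N
  rw [le_div_iff₀ hN, mul_comm]
  exact (Nat.lt_floor_add_one _).le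

lemma dist_latticeApprox_le (b : BallSpace d) :
    dist (latticeApprox N b) b ≤ (d + 1) / N := by
  have hN : (0 : ℝ) < N := Nat.cast_pos.2 (NeZero.pos N)
  refine max_le ?_ ?_
  · have hcoord : ∀ i, dist ((latticeApprox N b).1 i) (b.1 i) ≤ 1 / N := by
      intro i
      change |(⌊N * b.1 i⌋ : ℝ) / N - b.1 i| ≤ 1 / N
      have h1 := Int.floor_le (N * b.1 i)
      have h2 := Int.lt_floor_add_one (N * b.1 i)
      rw [div_sub' hN.ne', abs_div, abs_of_pos hN, div_le_div_iff_of_pos_right hN, abs_le]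
      constructor <;> linarith
    rw [EuclideanSpace.dist_eq]
    refine Real.sqrt_le_iff.2 ⟨by positivity, ?_⟩
    calc ∑ i, dist ((latticeApprox N b).1 i) (b.1 i) ^ 2 ≤ ∑ _i : Fin d, (1 / (N : ℝ)) ^ 2 :=
          Finset.sum_le_sum fun i _ => pow_le_pow_left₀ dist_nonneg (hcoord i) 2
      _ = d * (1 / (N : ℝ)) ^ 2 := by simp
      _ ≤ (d + 1) ^ 2 * (1 / (N : ℝ)) ^ 2 := by
          gcongr
          nlinarith [(Nat.cast_nonneg d : (0 : ℝ) ≤ d)]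
      _ = ((d + 1) / (N : ℝ)) ^ 2 := by ring
  · change |(⌊N * (b.2 : ℝ)⌋₊ + 1 : ℝ) / N - b.2| ≤ (d + 1) / N
    have hpos : (0 : ℝ) ≤ N * (b.2 : ℝ) := mul_nonneg hN.le (le_of_lt b.2.2)
    have h1 := Nat.floor_le hpos
    have h2 := Nat.lt_floor_add_one (N * (b.2 : ℝ))
    have hd : (0 : ℝ) ≤ d := Nat.cast_nonneg d
    rw [div_sub' hN.ne', abs_div, abs_of_pos hN, div_le_div_iff_of_pos_right hN, abs_le]
    constructor <;> linarith

/-- A compact exhaustion of the space of balls. -/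
def ballBox (d m : ℕ) : Set (BallSpace d) :=
  {b | (∀ i, |b.1 i| ≤ m + 1) ∧ 1 / ((m : ℝ) + 1) ≤ b.2 ∧ (b.2 : ℝ) ≤ m + 1}

lemma exists_ballBox_mem_nhds (b : BallSpace d) : ∃ m, ballBox d m ∈ 𝓝 b := by
  obtain ⟨m, hm⟩ := exists_nat_gt (‖b.1‖ + b.2 + 1 / b.2)
  have hb : (0 : ℝ) < b.2 := b.2.2
  have hb' : 0 < 1 / (b.2 : ℝ) := by positivity
  have hn := norm_nonneg b.1
  refine ⟨m, ?_⟩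
  have h1 : ∀ᶠ c : BallSpace d in 𝓝 b, ‖c.1‖ < m + 1 :=
    (continuous_fst.norm).continuousAt.eventually (gt_mem_nhds (by linarith))
  have h2 : ∀ᶠ c : BallSpace d in 𝓝 b, (c.2 : ℝ) < m + 1 :=
    (continuous_subtype_val.comp continuous_snd).continuousAt.eventually
      (gt_mem_nhds (by simp only [Function.comp]; linarith))
  have h3 : ∀ᶠ c : BallSpace d in 𝓝 b, 1 / ((m : ℝ) + 1) < c.2 := by
    refine (continuous_subtype_val.comp continuous_snd).continuousAt.eventually
      (lt_mem_nhds ?_)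
    exact (one_div_lt (by positivity) hb).2 (by linarith)
  filter_upwards [h1, h2, h3] with c hc1 hc2 hc3
  exact ⟨fun i => (PiLp.norm_apply_le c.1 i).trans hc1.le, hc3.le, hc2.le⟩

open scoped Classical in
/-- A finite set containing the lattice approximations of mesh `1 / N` of the balls in
`ballBox d m`. -/
noncomputable def latticeNet (d m N : ℕ) [NeZero N] : Finset (BallSpace d) :=
  ((Fintype.piFinset fun _ : Fin d => Finset.Icc (-(((m + 1) * N : ℕ) : ℤ)) ((m + 1) * N : ℕ)) ×ˢ
    Finset.range ((m + 1) * N + 1)).image (latticeBall N)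

lemma latticeApprox_mem_latticeNet {m : ℕ} {b : BallSpace d} (hb : b ∈ ballBox d m) :
    latticeApprox N b ∈ latticeNet d m N := by
  have hN : (0 : ℝ) < N := Nat.cast_pos.2 (NeZero.pos N)
  refine Finset.mem_image.2 ⟨_, Finset.mem_product.2 ⟨Fintype.mem_piFinset.2 fun i => ?_, ?_⟩, rfl⟩
  · have h := abs_le.1 (hb.1 i)
    refine Finset.mem_Icc.2 ⟨Int.le_floor.2 ?_, ?_⟩
    · push_cast
      nlinarith
    · refine Int.cast_le (R := ℝ).1 ((Int.floor_le _).trans ?_)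
      push_cast
      nlinarith
  · refine Finset.mem_range_succ_iff.2 (Nat.floor_le_of_le ?_)
    push_cast
    nlinarith [hb.2.2]

lemma card_latticeNet_le (d m : ℕ) : (latticeNet d m N).card ≤ (3 * (m + 1) * N) ^ (d + 1) := by
  refine Finset.card_image_le.trans ?_
  rw [Finset.card_product, Fintype.card_piFinset, Finset.prod_const, Finset.card_univ,
    Fintype.card_fin, Finset.card_range, Int.card_Icc, pow_succ]
  have hM : 1 ≤ (m + 1) * N := Nat.mul_pos m.succ_pos (NeZero.pos N)
  refine Nat.mul_le_mul (Nat.pow_le_pow_left ?_ _) ?_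
  · rw [mul_assoc]; omega
  · rw [mul_assoc]; omega

end Lattice

/-! ### Continuity of Gaussian fields on the space of balls -/

section Modification

open Filter Topology

variable {d : ℕ}

open scoped Classical in
/-- The pairs of points of the lattices of mesh `16⁻ⁿ` and `16⁻⁽ⁿ⁺¹⁾` in a bounded region that are
at distance of order `16⁻ⁿ` and whose radii are bounded below. -/
noncomputable def latticeLinks (d m n : ℕ) : Finset (BallSpace d × BallSpace d) :=
  ((latticeNet d m (16 ^ n) ∪ latticeNet d m (16 ^ (n + 1))) ×ˢ
    (latticeNet d m (16 ^ n) ∪ latticeNet d m (16 ^ (n + 1)))).filter fun p =>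
    (1 / ((m : ℝ) + 1) ≤ p.1.2 ∧ 1 / ((m : ℝ) + 1) ≤ p.2.2) ∧
      dist p.1 p.2 ≤ 3 * (d + 1) / 16 ^ n

lemma card_latticeLinks_le (d m n : ℕ) :
    (latticeLinks d m n).card ≤ (2 * (48 * (m + 1)) ^ (d + 1)) ^ 2 * (4 ^ n) ^ (4 * (d + 1)) := by
  classical
  have hcard : (latticeNet d m (16 ^ n) ∪ latticeNet d m (16 ^ (n + 1))).card ≤
      2 * (48 * (m + 1) * 16 ^ n) ^ (d + 1) := by
    refine (Finset.card_union_le _ _).trans ?_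
    rw [two_mul]
    refine add_le_add ((card_latticeNet_le _ d m).trans (Nat.pow_le_pow_left ?_ _))
      ((card_latticeNet_le _ d m).trans (Nat.pow_le_pow_left ?_ _))
    · gcongr; norm_num
    · rw [pow_succ]; apply le_of_eq; ring
  refine (Finset.card_filter_le _ _).trans ?_
  rw [Finset.card_product]
  refine (Nat.mul_le_mul hcard hcard).trans (le_of_eq ?_)
  rw [mul_pow _ (16 ^ n), show (16 : ℕ) ^ n = 4 ^ n * 4 ^ n by rw [← mul_pow]; norm_num,
    ← pow_two (4 ^ n), ← pow_mul (4 ^ n)]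
  generalize (48 * (m + 1)) ^ (d + 1) = u
  generalize 4 ^ n = w
  ring

lemma summable_pow_mul_exp_neg_mul_four_pow (p : ℕ) {κ : ℝ} (hκ : 0 < κ) :
    Summable fun n : ℕ => ((4 : ℝ) ^ n) ^ p * Real.exp (-κ * 4 ^ n) := by
  have h := (Real.summable_pow_mul_exp_neg_nat_mul p hκ).comp_injective
    (Nat.pow_right_injective (by norm_num : 2 ≤ 4))
  simpa [Function.comp_def] using h

/-- A Gaussian field on the space of balls whose increments have a variance that is locally
bounded by a multiple of the distance has a continuous modification. -/
theorem IsGaussianFieldMeasure.exists_continuous_modification {C : BallSpace d → BallSpace d → ℝ}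
    (hC : IsPosSemidefKernel C) {μ : Measure (BallSpace d → ℝ)} (hμ : IsGaussianFieldMeasure C μ)
    (hinc : ∀ ε : ℝ, 0 < ε → ∃ K > 0, ∀ b c : BallSpace d, ε ≤ b.2 → ε ≤ c.2 →
      C b b - 2 * C b c + C c c ≤ K * dist b c) :
    ∃ Y : BallSpace d → (BallSpace d → ℝ) → ℝ,
      IsModificationOf Y (canonicalField (BallSpace d)) μ ∧ HasContinuousSamplePaths Y μ := by
  have ha : Summable fun n : ℕ => ((1 : ℝ) / 2) ^ n := summable_geometric_two
  -- At distance of order `16⁻ⁿ`, an increment of size `2⁻ⁿ` has probability `exp (- κ 4ⁿ)`.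
  have htail : ∀ ε : ℝ, 0 < ε → ∃ κ > 0, ∀ (n : ℕ) (b c : BallSpace d), ε ≤ b.2 → ε ≤ c.2 →
      dist b c ≤ 3 * (d + 1) / 16 ^ n →
      μ {ω | (1 / 2) ^ n ≤ |canonicalField _ b ω - canonicalField _ c ω|} ≤
        ENNReal.ofReal (2 * Real.exp (-κ * 4 ^ n)) := by
    intro ε hε
    obtain ⟨K, hK, hKinc⟩ := hinc ε hε
    refine ⟨1 / (2 * (K * (3 * (d + 1)))), by positivity, fun n b c hb hc hbc => ?_⟩
    have hv : 0 < K * (3 * (d + 1) / 16 ^ n) := by positivity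
    refine (hμ.measure_le_abs_sub_le hC hv ((hKinc b c hb hc).trans (by gcongr))
      (by positivity : (0 : ℝ) ≤ (1 / 2) ^ n)).trans (le_of_eq ?_)
    congr 3
    rw [show (16 : ℝ) ^ n = 4 ^ n * 4 ^ n by rw [← mul_pow]; norm_num, ← pow_mul, mul_comm n 2,
      pow_mul, show ((1 : ℝ) / 2) ^ 2 = 1 / 4 by norm_num, one_div_pow]
    field_simp
  refine exists_continuous_modification_of_chaining (fun b => measurable_pi_apply b)
    (π := fun n => latticeApprox (16 ^ n)) (G := latticeLinks d) ha ?_ ?_ ?_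
  · intro m
    obtain ⟨κ, hκ, hκtail⟩ := htail (1 / ((m : ℝ) + 1)) (by positivity)
    have hsum : Summable fun n : ℕ => ((2 * (48 * ((m : ℝ) + 1)) ^ (d + 1)) ^ 2) *
        (2 * (((4 : ℝ) ^ n) ^ (4 * (d + 1)) * Real.exp (-κ * 4 ^ n))) :=
      ((summable_pow_mul_exp_neg_mul_four_pow _ hκ).mul_left 2).mul_left _
    refine ne_top_of_le_ne_top hsum.tsum_ofReal_ne_top (ENNReal.tsum_le_tsum fun n => ?_)
    refine (Finset.sum_le_card_nsmul _ _ (ENNReal.ofReal (2 * Real.exp (-κ * 4 ^ n)))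
      fun p hp => ?_).trans ?_
    · have hp' := (Finset.mem_filter.1 hp).2
      exact hκtail n p.1 p.2 hp'.1.1 hp'.1.2 hp'.2
    · rw [← ENNReal.ofReal_nsmul, nsmul_eq_mul]
      refine ENNReal.ofReal_le_ofReal ?_
      have hcard : ((latticeLinks d m n).card : ℝ) ≤
          (2 * (48 * ((m : ℝ) + 1)) ^ (d + 1)) ^ 2 * ((4 : ℝ) ^ n) ^ (4 * (d + 1)) := by
        exact_mod_cast card_latticeLinks_le d m n
      calc _ ≤ _ := mul_le_mul_of_nonneg_right hcard (by positivity)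
        _ = _ := by ring
  · intro b
    obtain ⟨κ, hκ, hκtail⟩ := htail b.2 b.2.2
    have hsum : Summable fun n : ℕ => 2 * (((4 : ℝ) ^ n) ^ 0 * Real.exp (-κ * 4 ^ n)) :=
      (summable_pow_mul_exp_neg_mul_four_pow 0 hκ).mul_left 2
    refine ne_top_of_le_ne_top hsum.tsum_ofReal_ne_top (ENNReal.tsum_le_tsum fun n => ?_)
    rw [pow_zero, one_mul]
    refine hκtail n _ b (le_latticeApprox_snd _ b) le_rfl ((dist_latticeApprox_le _ b).trans ?_)
    push_cast
    gcongr
    linarith [(Nat.cast_nonneg d : (0 : ℝ) ≤ d)]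
  · intro b
    obtain ⟨m, hm⟩ := exists_ballBox_mem_nhds b
    have happ : ∀ (n : ℕ) (c : BallSpace d),
        dist (latticeApprox (16 ^ n) c) c ≤ (d + 1) / (16 : ℝ) ^ n := fun n c => by
      simpa using dist_latticeApprox_le (16 ^ n) c
    refine ⟨m, ?_, fun n => ?_⟩
    · filter_upwards [hm] with c hc n
      refine Finset.mem_filter.2 ⟨Finset.mem_product.2
        ⟨Finset.mem_union_left _ (latticeApprox_mem_latticeNet _ hc),
        Finset.mem_union_right _ (latticeApprox_mem_latticeNet _ hc)⟩,
        ⟨hc.2.1.trans (le_latticeApprox_snd _ c), hc.2.1.trans (le_latticeApprox_snd _ c)⟩, ?_⟩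
      have h1 := happ n c
      have h2 := happ (n + 1) c
      have h3 : ((d : ℝ) + 1) / 16 ^ (n + 1) ≤ (d + 1) / 16 ^ n := by
        gcongr
        · norm_num
        · omega
      have h4 : (0 : ℝ) ≤ (d + 1) / 16 ^ n := by positivity
      calc _ ≤ _ := dist_triangle_right _ _ c
        _ ≤ 3 * ((d + 1) / 16 ^ n) := by linarith
        _ = _ := by ring
    · have hb := mem_of_mem_nhds hm
      have hδ : (0 : ℝ) < (d + 1) / 16 ^ n := by positivity
      filter_upwards [hm, Metric.ball_mem_nhds b hδ] with c hc hcb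
      refine Finset.mem_filter.2 ⟨Finset.mem_product.2
        ⟨Finset.mem_union_left _ (latticeApprox_mem_latticeNet _ hc),
        Finset.mem_union_left _ (latticeApprox_mem_latticeNet _ hb)⟩,
        ⟨hc.2.1.trans (le_latticeApprox_snd _ c), hb.2.1.trans (le_latticeApprox_snd _ b)⟩, ?_⟩
      have h1 := happ n c
      have h2 := happ n b
      have h3 := (Metric.mem_ball.1 hcb).le
      calc _ ≤ _ := dist_triangle4_right _ _ c b
        _ ≤ 3 * ((d + 1) / 16 ^ n) := by linarith
        _ = _ := by ring

end Modification

/-! ### Random continuous functions -/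

section RandomFunction

open Filter Topology Set

variable {T Ω : Type*} {mΩ : MeasurableSpace Ω}

/-- A random continuous function is Borel measurable as soon as its values are. -/
lemma measurable_continuousMap_of_eval [TopologicalSpace T] [SecondCountableTopology T]
    [LocallyCompactSpace T] {F : Ω → C(T, ℝ)} (hF : ∀ t, Measurable fun ω => F ω t) :
    Measurable F := by
  rw [BorelSpace.measurable_eq (α := C(T, ℝ)),
    borel_eq_generateFrom_of_subbasis (ContinuousMap.compactOpen_eq (X := T) (Y := ℝ))]
  refine measurable_generateFrom ?_
  rintro _ ⟨K, hK, U, hU, rfl⟩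
  obtain ⟨D, hDc, hDd⟩ := TopologicalSpace.exists_countable_dense K
  -- `f` maps `K` into `U` iff `f '' K` has positive distance to the complement of `U`.
  let V : ℕ → Set ℝ := fun n => {x | ∀ y ∈ Uᶜ, 1 / ((n : ℝ) + 1) ≤ dist x y}
  have hV : ∀ n, IsClosed (V n) := fun n => by
    simp only [V, ofPred_forall]
    exact isClosed_biInter fun y _ => isClosed_le continuous_const
      (continuous_id.dist continuous_const)
  have hset : F ⁻¹' {f | MapsTo f K U} = ⋃ n, ⋂ t ∈ D, {ω | F ω t ∈ V n} := by
    ext ω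
    simp only [mem_preimage, mem_ofPred_eq, mem_iUnion, mem_iInter]
    constructor
    · intro h
      obtain ⟨r, hr, hrd⟩ := Metric.exists_pos_forall_lt_edist (hK.image (F ω).continuous)
        (show IsOpen U from hU).isClosed_compl (disjoint_compl_right_iff_subset.2 h.image_subset)
      obtain ⟨n, hn⟩ := exists_nat_one_div_lt (NNReal.coe_pos.2 hr)
      refine ⟨n, fun t _ y hy => ?_⟩
      have h1 := hrd _ ⟨t, t.2, rfl⟩ y hy
      rw [edist_nndist, ENNReal.coe_lt_coe, ← NNReal.coe_lt_coe, coe_nndist] at h1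
      exact (hn.trans h1).le
    · rintro ⟨n, hn⟩ t ht
      have hcl : IsClosed {t : K | F ω t ∈ V n} :=
        (hV n).preimage ((F ω).continuous.comp continuous_subtype_val)
      have huniv : {t : K | F ω t ∈ V n} = univ :=
        hcl.closure_eq ▸ (hDd.mono hn).closure_eq
      have hmem : F ω t ∈ V n := by
        have : (⟨t, ht⟩ : K) ∈ {t : K | F ω t ∈ V n} := huniv ▸ mem_univ _
        exact this
      by_contra hU'
      have := hmem _ hU'
      rw [dist_self] at this
      exact absurd this (not_le.2 (by positivity))
  rw [hset]
  exact .iUnion fun n => .biInter hDc fun t _ => hF t (hV n).measurableSet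

/-- A pointwise limit of centered real Gaussian variables is Gaussian. -/
lemma hasGaussianLaw_of_tendsto {μ : Measure Ω} {Z : ℕ → Ω → ℝ} {W : Ω → ℝ}
    (hZ : ∀ n, HasGaussianLaw (Z n) μ) (hmean : ∀ n, ∫ ω, Z n ω ∂μ = 0)
    (hlim : ∀ ω, Tendsto (fun n => Z n ω) atTop (𝓝 (W ω))) : HasGaussianLaw W μ := by
  have hprob := (hZ 0).isProbabilityMeasure
  have hW : AEMeasurable W μ :=
    aemeasurable_of_tendsto_metrizable_ae' (fun n => (hZ n).aemeasurable)
      (Eventually.of_forall hlim)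
  have hprobW := Measure.isProbabilityMeasure_map hW
  have hmap : ∀ (V : Ω → ℝ), AEMeasurable V μ → ∀ s : ℝ,
      charFun (μ.map V) s = ∫ ω, Complex.exp (s * V ω * Complex.I) ∂μ := fun V hV s => by
    rw [charFun_apply_real, integral_map hV (by fun_prop)]
  have hchar : ∀ n (s : ℝ), charFun (μ.map (Z n)) s =
      Complex.exp ((-(Var[Z n; μ] * s ^ 2 / 2) : ℝ)) := fun n s => by
    rw [(hZ n).map_eq_gaussianReal, charFun_gaussianReal, hmean,
      Real.coe_toNNReal _ (variance_nonneg _ _)]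
    push_cast
    congr 1
    ring
  have hconv : ∀ s : ℝ, Tendsto (fun n => charFun (μ.map (Z n)) s) atTop
      (𝓝 (charFun (μ.map W) s)) := by
    intro s
    simp only [hmap _ (hZ _).aemeasurable, hmap _ hW]
    refine tendsto_integral_of_dominated_convergence (fun _ => 1) (fun n => ?_)
      (integrable_const _) (fun n => Eventually.of_forall fun ω => ?_)
      (Eventually.of_forall fun ω => ?_)
    · have := (hZ n).aemeasurable
      exact AEMeasurable.aestronglyMeasurable (by fun_prop)
    · rw [← Complex.ofReal_mul, Complex.norm_exp_ofReal_mul_I]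
    · have hc : Continuous fun x : ℝ => Complex.exp (s * x * Complex.I) := by fun_prop
      exact (hc.tendsto _).comp (hlim ω)
  -- The limit of the characteristic functions does not vanish near `0`, so the variances converge.
  have hnear : ∀ᶠ s in 𝓝[≠] (0 : ℝ), charFun (μ.map W) s ≠ 0 := by
    refine eventually_nhdsWithin_of_eventually_nhds
      (continuous_charFun.continuousAt.eventually_ne ?_)
    simp
  obtain ⟨s₀, hs₀, hs₀'⟩ := (hnear.and self_mem_nhdsWithin).exists
  have hs₀ne : s₀ ≠ 0 := hs₀'
  have hlog := (hconv s₀).norm.log (norm_ne_zero_iff.2 hs₀)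
  simp only [hchar, Complex.norm_exp_ofReal, Real.log_exp] at hlog
  have hvar : Tendsto (fun n => Var[Z n; μ]) atTop
      (𝓝 (Real.log ‖charFun (μ.map W) s₀‖ * (-2 / s₀ ^ 2))) := by
    refine (hlog.mul_const (-2 / s₀ ^ 2)).congr fun n => ?_
    field_simp
  set v := Real.log ‖charFun (μ.map W) s₀‖ * (-2 / s₀ ^ 2)
  have hv : 0 ≤ v := ge_of_tendsto' hvar fun n => variance_nonneg _ _
  have hlaw : μ.map W = gaussianReal 0 v.toNNReal := by
    refine Measure.ext_of_charFun (funext fun s => tendsto_nhds_unique (hconv s) ?_)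
    simp only [hchar]
    have h1 : Tendsto (fun n => (-(Var[Z n; μ] * s ^ 2 / 2) : ℝ)) atTop
        (𝓝 (-(v * s ^ 2 / 2))) := ((hvar.mul_const _).div_const _).neg
    have h2 := (Complex.continuous_exp.comp Complex.continuous_ofReal).continuousAt.tendsto.comp h1
    have h3 : charFun (gaussianReal 0 v.toNNReal) s = Complex.exp ((-(v * s ^ 2 / 2) : ℝ)) := by
      rw [charFun_gaussianReal, Real.coe_toNNReal _ hv]
      push_cast
      congr 1
      ring
    rw [h3]
    exact h2
  exact ⟨hlaw ▸ inferInstance⟩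

variable [MetricSpace T]

/-- A finite partition of unity on a compact set, subordinate to small balls. -/
lemma exists_finset_partitionOfUnity {K : Set T} (hK : IsCompact K) {δ : ℝ} (hδ : 0 < δ) :
    ∃ (I : Finset T) (ψ : T → C(T, ℝ)), ∀ x ∈ K, (∀ t ∈ I, 0 ≤ ψ t x) ∧ ∑ t ∈ I, ψ t x = 1 ∧
      ∀ t ∈ I, ψ t x ≠ 0 → dist x t < δ := by
  classical
  obtain ⟨I, -, hI, hcover⟩ := hK.finite_cover_balls hδ
  lift I to Finset T using hI
  obtain ⟨ρ, hρ⟩ := PartitionOfUnity.exists_isSubordinate_of_locallyFinite hK.isClosed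
    (fun t : I => Metric.ball (t : T) δ) (fun _ => Metric.isOpen_ball)
    (locallyFinite_of_finite _) (by simpa [iUnion_subtype] using hcover)
  refine ⟨I, fun t => if h : t ∈ I then ρ ⟨t, h⟩ else 0, fun x hx => ⟨fun t ht => ?_, ?_,
    fun t ht hne => ?_⟩⟩
  · simpa [ht] using ρ.nonneg ⟨t, ht⟩ x
  · rw [← ρ.sum_eq_one hx, finsum_eq_sum_of_fintype, ← Finset.sum_coe_sort I]
    exact Finset.sum_congr rfl fun t _ => by simp
  · simp only [ht, dif_pos] at hne
    exact hρ ⟨t, ht⟩ (subset_tsupport _ hne)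

/-- On a `σ`-compact space, continuous functions are limits of interpolations which are linear
and involve finitely many of their values. -/
lemma exists_interpolation [WeaklyLocallyCompactSpace T] [SigmaCompactSpace T] :
    ∃ (I : ℕ → Finset T) (ψ : ℕ → T → C(T, ℝ)), ∀ f : C(T, ℝ),
      Tendsto (fun n => ∑ t ∈ I n, f t • ψ n t) atTop (𝓝 f) := by
  let E := CompactExhaustion.choice T
  choose I ψ h using fun n : ℕ => exists_finset_partitionOfUnity (E.isCompact n)
    (Nat.one_div_pos_of_nat (α := ℝ) (n := n))
  refine ⟨I, ψ, fun f => ?_⟩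
  rw [ContinuousMap.tendsto_iff_forall_isCompact_tendstoUniformlyOn]
  intro K hK
  rw [Metric.tendstoUniformlyOn_iff]
  intro ε hε
  have hunif := hK.uniformContinuousAt_of_continuousAt f
    (fun a _ => f.continuous.continuousAt) (Metric.dist_mem_uniformity (half_pos hε))
  obtain ⟨δ, hδ, hδf⟩ := Metric.mem_uniformity_dist.1 hunif
  obtain ⟨n₁, hn₁⟩ := exists_nat_one_div_lt hδ
  obtain ⟨n₂, hn₂⟩ := E.exists_superset_of_isCompact hK
  filter_upwards [eventually_ge_atTop n₁, eventually_ge_atTop n₂] with n hn hn' x hx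
  obtain ⟨h1, h2, h3⟩ := h n x (E.subset hn' (hn₂ hx))
  have hfx : f x = ∑ t ∈ I n, ψ n t x * f x := by rw [← Finset.sum_mul, h2, one_mul]
  have hsum : (∑ t ∈ I n, f t • ψ n t) x = ∑ t ∈ I n, ψ n t x * f t := by
    simp [ContinuousMap.sum_apply, mul_comm]
  rw [hsum, Real.dist_eq, hfx, ← Finset.sum_sub_distrib]
  refine (Finset.abs_sum_le_sum_abs _ _).trans_lt (lt_of_le_of_lt ?_ (half_lt_self hε))
  calc ∑ t ∈ I n, |ψ n t x * f x - ψ n t x * f t| ≤ ∑ t ∈ I n, ψ n t x * (ε / 2) := by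
        refine Finset.sum_le_sum fun t ht => ?_
        rw [← mul_sub, abs_mul, abs_of_nonneg (h1 t ht)]
        rcases eq_or_ne (ψ n t x) 0 with h0 | h0
        · simp [h0]
        · refine mul_le_mul_of_nonneg_left (le_of_lt ?_) (h1 t ht)
          have hd : dist x t < δ := (h3 t ht h0).trans
            ((one_div_le_one_div_of_le (by positivity) (by gcongr)).trans_lt hn₁)
          exact hδf hd hx
    _ = ε / 2 := by rw [← Finset.sum_mul, h2, one_mul]

/-- The law of a random continuous function which is a centered Gaussian process is a Gaussian
measure on `C(T)`: a continuous linear functional is a pointwise limit of linear combinations of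
evaluations. -/
lemma ProbabilityTheory.IsGaussianProcess.isGaussian_map_continuousMap [LocallyCompactSpace T]
    [SecondCountableTopology T] {μ : Measure Ω} {F : Ω → C(T, ℝ)}
    (hmeas : ∀ t, Measurable fun ω => F ω t) (hF : IsGaussianProcess (fun t ω => F ω t) μ)
    (hmean : ∀ t, ∫ ω, F ω t ∂μ = 0) : IsGaussian (μ.map F) := by
  have hFm : Measurable F := measurable_continuousMap_of_eval hmeas
  have hprob := hF.isProbabilityMeasure
  obtain ⟨I, ψ, hψ⟩ := exists_interpolation (T := T)
  refine isGaussian_of_isGaussian_map fun L => ?_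
  rw [Measure.map_map L.continuous.measurable hFm]
  refine (hasGaussianLaw_of_tendsto (Z := fun n ω => ∑ t ∈ I n, L (ψ n t) • F ω t) (fun n => ?_)
    (fun n => ?_) fun ω => ?_).isGaussian_map
  · exact (hF.smul fun t => L (ψ n t)).hasGaussianLaw_fun_sum
  · simp only [smul_eq_mul]
    rw [integral_finsetSum _ fun t _ => ((hF.hasGaussianLaw_eval t).integrable.const_mul _)]
    simp [integral_const_mul, hmean]
  · have h := (L.continuous.tendsto _).comp (hψ (F ω))
    refine h.congr fun n => ?_
    simp [map_sum, mul_comm]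

end RandomFunction

section RandomFunction

open Filter Topology

variable {T Ω : Type*} {mΩ : MeasurableSpace Ω} {μ : Measure Ω}

/-- Almost sure continuity of the paths may be assumed on a measurable set of full measure. -/
lemma HasContinuousSamplePaths.exists_measurableSet [TopologicalSpace T] [IsProbabilityMeasure μ]
    {Y : T → Ω → ℝ} (hY : HasContinuousSamplePaths Y μ) :
    ∃ S : Set Ω, MeasurableSet S ∧ μ S = 1 ∧ ∀ ω ∈ S, Continuous fun t => Y t ω := by
  obtain ⟨N, hN, hNm, hN0⟩ := exists_measurable_superset_of_null (ae_iff.1 hY)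
  refine ⟨Nᶜ, hNm.compl, (prob_compl_eq_one_iff hNm).2 hN0, fun ω hω => ?_⟩
  by_contra h
  exact hω (hN h)

lemma map_comap_subtype_val_of_prob_eq_one [IsProbabilityMeasure μ] {S : Set Ω}
    (hS : MeasurableSet S) (hS1 : μ S = 1) :
    (μ.comap (Subtype.val : S → Ω)).map Subtype.val = μ := by
  rw [map_comap_subtype_coe hS]
  exact Measure.restrict_eq_self_of_ae_mem ((mem_ae_iff_prob_eq_one hS).2 hS1)

lemma measurable_pathMap [TopologicalSpace T] [SecondCountableTopology T] [LocallyCompactSpace T]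
    {Y : T → Ω → ℝ} (hY : ∀ t, Measurable (Y t)) {S : Set Ω}
    (h : ∀ ω ∈ S, Continuous fun t => Y t ω) : Measurable (pathMap Y S h) :=
  measurable_continuousMap_of_eval fun t => (hY t).comp measurable_subtype_coe

variable {X Y : T → Ω → ℝ} {S : Set Ω}

lemma isGaussian_pathMeasure [MetricSpace T] [SecondCountableTopology T] [LocallyCompactSpace T]
    (hX : IsGaussianProcess X μ) (hmean : ∀ t, ∫ ω, X t ω ∂μ = 0) (hYX : IsModificationOf Y X μ)
    (h : ∀ ω ∈ S, Continuous fun t => Y t ω) (hS : MeasurableSet S) (hS1 : μ S = 1) :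
    IsGaussian (pathMeasure μ Y S h) := by
  have hprob := hX.isProbabilityMeasure
  have hval := map_comap_subtype_val_of_prob_eq_one hS hS1
  have hY : IsGaussianProcess Y μ := hX.congr fun t => (hYX.2 t).symm
  refine IsGaussianProcess.isGaussian_map_continuousMap
    (fun t => (hYX.1 t).comp measurable_subtype_coe) ⟨fun I => ⟨?_⟩⟩ fun t => ?_
  · have hG := (hY.hasGaussianLaw I).isGaussian_map
    have hm : Measurable fun ω => I.restrict (Y · ω) :=
      measurable_pi_lambda _ fun t => hYX.1 t
    rw [← hval, Measure.map_map hm measurable_subtype_coe] at hG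
    exact hG
  · rw [← hmean t, ← integral_congr_ae (hYX.2 t)]
    conv_rhs => rw [← hval]
    exact (integral_map measurable_subtype_coe.aemeasurable
      (hYX.1 t).aestronglyMeasurable).symm

lemma pathMeasure_map_eval [TopologicalSpace T] [SecondCountableTopology T] [LocallyCompactSpace T]
    [IsProbabilityMeasure μ] (hX : ∀ t, Measurable (X t)) (hYX : IsModificationOf Y X μ)
    (h : ∀ ω ∈ S, Continuous fun t => Y t ω) (hS : MeasurableSet S) (hS1 : μ S = 1) :
    (pathMeasure μ Y S h).map (fun (f : C(T, ℝ)) (t : T) => f t) = μ.map fun ω t => X t ω := by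
  have hY : Measurable fun ω t => Y t ω := measurable_pi_lambda _ hYX.1
  have heval : Measurable fun (f : C(T, ℝ)) (t : T) => f t :=
    measurable_pi_lambda _ fun t => (continuous_eval_const t).measurable
  rw [← map_eq_of_forall_ae_eq hY.aemeasurable (measurable_pi_lambda _ hX).aemeasurable hYX.2,
    pathMeasure, Measure.map_map heval (measurable_pathMap hYX.1 h)]
  conv_rhs => rw [← map_comap_subtype_val_of_prob_eq_one hS hS1,
    Measure.map_map hY measurable_subtype_coe]
  rfl

end RandomFunction

/-! ### The Gaussian random field of a strictly positive operator -/

theorem mainTheorem3 (d : ℕ) (A : L2Space d →L[ℝ] L2Space d) (hA : IsStrictlyPositiveOp A) :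
    -- the covariance function is continuous on `B_d × B_d`
    (Continuous fun p : BallSpace d × BallSpace d => ballCov A p.1 p.2) ∧
    -- the Gaussian measure `μ` on `ℝ^(B_d)` with this covariance exists and is unique
    ∃ μ : Measure (BallSpace d → ℝ),
      IsGaussianFieldMeasure (ballCov A) μ ∧
      (∀ μ' : Measure (BallSpace d → ℝ), IsGaussianFieldMeasure (ballCov A) μ' → μ' = μ) ∧
      IsProbabilityMeasure μ ∧
      -- the canonical field is a centered Gaussian field with this covariance
      IsGaussianProcess (canonicalField (BallSpace d)) μ ∧
      (∀ b, ∫ ω, canonicalField (BallSpace d) b ω ∂μ = 0) ∧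
      (∀ b c, ∫ ω, canonicalField (BallSpace d) b ω * canonicalField (BallSpace d) c ω ∂μ
        = ballCov A b c) ∧
      -- it is continuous in `L²`
      IsL2Continuous (canonicalField (BallSpace d)) μ ∧
      -- it has a modification with continuous sample paths
      (∃ Y : BallSpace d → (BallSpace d → ℝ) → ℝ,
        IsModificationOf Y (canonicalField (BallSpace d)) μ ∧ HasContinuousSamplePaths Y μ) ∧
      -- every such modification induces a Borel Gaussian probability measure on `C(B_d)`, for
      -- which the evaluations have the same joint law `μ` as the canonical field
      ∀ Y : BallSpace d → (BallSpace d → ℝ) → ℝ,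
        IsModificationOf Y (canonicalField (BallSpace d)) μ → HasContinuousSamplePaths Y μ →
        (∃ S : Set (BallSpace d → ℝ), MeasurableSet S ∧ μ S = 1 ∧
          ∀ ω ∈ S, Continuous fun b => Y b ω) ∧
        ∀ (S : Set (BallSpace d → ℝ)) (h : ∀ ω ∈ S, Continuous fun b => Y b ω),
          MeasurableSet S → μ S = 1 →
          Measurable (pathMap Y S h) ∧
          IsProbabilityMeasure (pathMeasure μ Y S h) ∧
          IsGaussian (pathMeasure μ Y S h) ∧
          (pathMeasure μ Y S h).map (fun (f : C(BallSpace d, ℝ)) (b : BallSpace d) => f b) = μ := by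
  have hC := hA.isPosSemidefKernel_ballCov
  have : LocallyCompactSpace (Set.Ioi (0 : ℝ)) := isOpen_Ioi.locallyCompactSpace
  obtain ⟨μ, hμ⟩ := exists_isGaussianFieldMeasure hC
  have hprob := hμ.isProbabilityMeasure
  refine ⟨continuous_ballCov A, μ, hμ, fun μ' hμ' => IsProjectiveLimit.unique hμ' hμ, hprob,
    hμ.isGaussianProcess, hμ.integral_eval, hμ.integral_mul hC,
    hμ.isL2Continuous hC (continuous_ballCov A), ?_, fun Y hYX hYc =>
    ⟨hYc.exists_measurableSet, fun S h hS hS1 => ?_⟩⟩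
  · refine hμ.exists_continuous_modification hC fun ε hε => ?_
    have hv := ballVolInv_pos (d := d) hε
    refine ⟨(‖A‖ + 1) * (4 * (d + 1) * (ballVolInv d ε / ε)), by positivity,
      fun b c hb hc => (hA.ballCov_sub_le b c).trans ?_⟩
    rw [mul_assoc]
    exact mul_le_mul (by linarith) (norm_normIndicator_sub_sq_le_of_le hε hb hc)
      (by positivity) (by positivity)
  · have hG := isGaussian_pathMeasure hμ.isGaussianProcess hμ.integral_eval hYX h hS hS1
    refine ⟨measurable_pathMap hYX.1 h, inferInstance, hG, ?_⟩
    rw [pathMeasure_map_eval (fun b => measurable_pi_apply b) hYX h hS hS1]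
    exact Measure.map_id
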